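/- Let $\gamma:\{a,b,c\}^*\to\{a,b,c\}^*$ be the morphism $a\mapsto aca,\ b\mapsto cab,\ c\mapsto b$, and let $\mathbf{x}_\gamma=acabacacab\cdots$ be the right-infinite word that starts with $a$ and is fixed by $\gamma$. Let $\pi:\{x,y\}^*\to\{a,b,c\}^*$ be the morphism $x\mapsto ac,\ y\mapsto ab$. Let $\mathrm{Stab}(\mathbf{x}_\gamma)$ be the monoid of all (possibly erasing) morphisms $\varphi:\{a,b,c\}^*\to\{a,b,c\}^*$ such that $\varphi(\mathbf{x}_\gamma)=\mathbf{x}_\gamma$. Then $$\mathrm{Stab}(\mathbf{x}_\gamma)=\{\varphi : \text{there exists an integer } k\ge 0 \text{ such that } \varphi\circ\pi=\gamma^k\circ\pi\}.$$ Equivalently, a morphism $\varphi:\{a,b,c\}^*\to\{a,b,c\}^*$ belongs to $\mathrm{Stab}(\mathbf{x}_\gamma)$ if and only if there is an integer $k\ge 0$ such that $\varphi(ac)=\gamma^k(ac)$ and $\varphi(ab)=\gamma^k(ab)$. -/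

import Mathlib

namespace MorphicWords

/-- The alphabet `{a, b, c}`. -/
inductive ABC : Type
  | a | b | c

/-- The alphabet `{x, y}`. -/
inductive XY : Type
  | x | y

/-- The prefix `w_0 w_1 ⋯ w_{n-1}` of length `n` of a right-infinite word `w`. -/
def pre {A : Type*} (w : ℕ → A) (n : ℕ) : FreeMonoid A :=
  FreeMonoid.ofList ((List.range n).map w)

/-- `HasImage φ w v` says that `φ(w) = v` for the natural extension of the (possibly erasing)
morphism `φ` to right-infinite words: the infinite product `φ(w_0) φ(w_1) φ(w_2) ⋯` is the
right-infinite word `v`. That is, every finite partial product is a prefix of `v`, and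
the lengths of the partial products are unbounded. -/
def HasImage {A B F : Type*} [FunLike F (FreeMonoid A) (FreeMonoid B)]
    [MonoidHomClass F (FreeMonoid A) (FreeMonoid B)] (φ : F) (w : ℕ → A) (v : ℕ → B) : Prop :=
  (∀ n, ∃ m, φ (pre w n) = pre v m) ∧ ∀ m, ∃ n, m ≤ (φ (pre w n)).length

theorem length_pre {A : Type*} (w : ℕ → A) (n : ℕ) : (pre w n).length = n := by
  simp [pre, FreeMonoid.length]

theorem pre_add {A : Type*} (w : ℕ → A) (n k : ℕ) :
    ∃ u, pre w (n + k) = pre w n * u := by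
  refine ⟨FreeMonoid.ofList ((List.range k).map (fun i => w (n + i))), ?_⟩
  simp only [pre, List.range_add, List.map_append, FreeMonoid.ofList_append, List.map_map]
  rfl

theorem length_map_pre_mono {A B F : Type*} [FunLike F (FreeMonoid A) (FreeMonoid B)]
    [MonoidHomClass F (FreeMonoid A) (FreeMonoid B)] (φ : F) (w : ℕ → A)
    {n m : ℕ} (h : n ≤ m) : (φ (pre w n)).length ≤ (φ (pre w m)).length := by
  obtain ⟨k, rfl⟩ := Nat.exists_eq_add_of_le h
  obtain ⟨u, hu⟩ := pre_add w n k
  rw [hu, map_mul, FreeMonoid.length_mul]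
  omega

/-- The stabilizer of a right-infinite word `w`: the monoid (under composition) of all
morphisms `φ` with `φ(w) = w`. -/
def stabilizer {A : Type*} (w : ℕ → A) : Submonoid (Monoid.End (FreeMonoid A)) where
  carrier := {φ | HasImage φ w w}
  one_mem' := ⟨fun n => ⟨n, rfl⟩, fun m => ⟨m, (length_pre w m).ge⟩⟩
  mul_mem' := by
    rintro φ ψ ⟨h1, h2⟩ ⟨h3, h4⟩
    refine ⟨fun n => ?_, fun m => ?_⟩
    · obtain ⟨k, hk⟩ := h3 n
      obtain ⟨l, hl⟩ := h1 k
      exact ⟨l, (congrArg φ hk).trans hl⟩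
    · obtain ⟨n, hn⟩ := h2 m
      obtain ⟨n', hn'⟩ := h4 n
      obtain ⟨k, hk⟩ := h3 n'
      rw [hk, length_pre] at hn'
      refine ⟨n', hn.trans ?_⟩
      have e : (φ * ψ) (pre w n') = φ (pre w k) := congrArg φ hk
      rw [e]
      exact length_map_pre_mono φ w hn'

open FreeMonoid (of)

/-- The morphism `γ : a ↦ aca, b ↦ cab, c ↦ b`. -/
def γ : Monoid.End (FreeMonoid ABC) :=
  FreeMonoid.lift fun
    | ABC.a => of ABC.a * of ABC.c * of ABC.a
    | ABC.b => of ABC.c * of ABC.a * of ABC.b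
    | ABC.c => of ABC.b

/-- The morphism `π : x ↦ ac, y ↦ ab`. -/
def π : FreeMonoid XY →* FreeMonoid ABC :=
  FreeMonoid.lift fun
    | XY.x => of ABC.a * of ABC.c
    | XY.y => of ABC.a * of ABC.b

/-- The right-infinite word `lim γⁿ(a)`: its letter of index `i` is the letter of index `i` of
`γ^i(a)`, a word of length greater than `i`. By `existsUnique_fixed` and `xγ_fixed` below, it is
the unique right-infinite word that starts with `a` and is fixed by `γ`. -/
def xγ : ℕ → ABC := fun i => (FreeMonoid.toList ((γ ^ i) (of ABC.a))).getD i ABC.a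

theorem length_le_γ (u : FreeMonoid ABC) : u.length ≤ (γ u).length := by
  induction u using FreeMonoid.inductionOn' with
  | one => simp
  | of_mul l u ih =>
    rw [map_mul, FreeMonoid.length_mul, FreeMonoid.length_mul]
    have : (of l).length ≤ (γ (of l)).length := by
      cases l
      · exact Nat.le_add_left 1 2
      · exact Nat.le_add_left 1 2
      · exact Nat.le_refl 1
    omega

theorem γ_pow_succ_apply (n : ℕ) (u : FreeMonoid ABC) : (γ ^ (n + 1)) u = γ ((γ ^ n) u) := by
  rw [pow_succ']; rfl

theorem length_le_γ_pow (n : ℕ) (u : FreeMonoid ABC) : u.length ≤ ((γ ^ n) u).length := by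
  induction n with
  | zero => exact le_rfl
  | succ n ih => rw [γ_pow_succ_apply]; exact ih.trans (length_le_γ _)

theorem γ_pow_succ_a (n : ℕ) : (γ ^ (n + 1)) (of ABC.a) =
    (γ ^ n) (of ABC.a) * (γ ^ n) (of ABC.c * of ABC.a) := by
  rw [pow_succ, ← map_mul, ← mul_assoc]; rfl

theorem lt_length_γ_pow_a (n : ℕ) : n < ((γ ^ n) (of ABC.a)).length := by
  induction n with
  | zero => exact Nat.zero_lt_one
  | succ n ih =>
    rw [γ_pow_succ_a, FreeMonoid.length_mul]
    have := length_le_γ_pow n (of ABC.c * of ABC.a)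
    simp only [FreeMonoid.length_mul, FreeMonoid.length_of] at this
    omega

theorem γ_pow_add_a (n k : ℕ) : ∃ u, (γ ^ (n + k)) (of ABC.a) = (γ ^ n) (of ABC.a) * u := by
  induction k with
  | zero => exact ⟨1, by simp⟩
  | succ k ih =>
    obtain ⟨u, hu⟩ := ih
    refine ⟨u * (γ ^ (n + k)) (of ABC.c * of ABC.a), ?_⟩
    rw [← add_assoc, γ_pow_succ_a, hu, mul_assoc]

theorem xγ_eq {n i : ℕ} (h : i < ((γ ^ n) (of ABC.a)).length) :
    xγ i = (FreeMonoid.toList ((γ ^ n) (of ABC.a))).getD i ABC.a := by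
  have key : ∀ m k : ℕ, i < ((γ ^ m) (of ABC.a)).length →
      (FreeMonoid.toList ((γ ^ (m + k)) (of ABC.a))).getD i ABC.a =
      (FreeMonoid.toList ((γ ^ m) (of ABC.a))).getD i ABC.a := by
    intro m k hm
    obtain ⟨u, hu⟩ := γ_pow_add_a m k
    rw [hu, FreeMonoid.toList_mul, List.getD_append _ _ _ _ hm]
  rcases le_total n i with hni | hni
  · obtain ⟨k, hk⟩ := Nat.exists_eq_add_of_le hni
    have := key n k h
    rw [← hk] at this
    exact this
  · obtain ⟨k, hk⟩ := Nat.exists_eq_add_of_le hni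
    have := key i k (lt_length_γ_pow_a i)
    rw [← hk] at this
    exact this.symm

theorem pre_xγ (n : ℕ) : pre xγ ((γ ^ n) (of ABC.a)).length = (γ ^ n) (of ABC.a) := by
  apply FreeMonoid.toList.injective
  refine List.ext_getElem (by simp [pre, FreeMonoid.length]) fun i h1 h2 => ?_
  have e := xγ_eq (n := n) (i := i) h2
  rw [List.getD_eq_getElem _ _ h2] at e
  simpa [pre] using e

theorem eq_pre_of_mul {A : Type*} {w : ℕ → A} {m : ℕ} {u v : FreeMonoid A}
    (h : u * v = pre w m) : u = pre w u.length := by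
  have hl : u.length ≤ m := by
    have := congrArg FreeMonoid.length h
    rw [FreeMonoid.length_mul, length_pre] at this
    omega
  obtain ⟨k, hk⟩ := Nat.exists_eq_add_of_le hl
  obtain ⟨t, ht⟩ := pre_add w u.length k
  rw [← hk, ← h] at ht
  exact (List.append_inj ht (length_pre w u.length).symm).1

/-- `γ(x_γ) = x_γ`. -/
theorem xγ_fixed : xγ 0 = ABC.a ∧ HasImage γ xγ xγ := by
  refine ⟨rfl, fun n => ?_, fun m => ⟨m, ?_⟩⟩
  · obtain ⟨k, hk⟩ := Nat.exists_eq_add_of_le (lt_length_γ_pow_a n).le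
    obtain ⟨u, hu⟩ := pre_add xγ n k
    rw [← hk, pre_xγ] at hu
    have e := congrArg γ hu
    rw [← γ_pow_succ_apply, map_mul, ← pre_xγ] at e
    exact ⟨_, eq_pre_of_mul e.symm⟩
  · exact (length_pre xγ m).ge.trans (length_le_γ _)

/-- Exactly one right-infinite word starts with `a` and is fixed by `γ`. -/
theorem existsUnique_fixed : ∃! w : ℕ → ABC, w 0 = ABC.a ∧ HasImage γ w w := by
  refine ⟨xγ, xγ_fixed, ?_⟩
  rintro w ⟨h0, h1, -⟩
  have key : ∀ n, pre w ((γ ^ n) (of ABC.a)).length = (γ ^ n) (of ABC.a) := by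
    intro n
    induction n with
    | zero =>
      change FreeMonoid.ofList [w 0] = of ABC.a
      rw [h0]; rfl
    | succ n ih =>
      obtain ⟨m, hm⟩ := h1 ((γ ^ n) (of ABC.a)).length
      rw [ih, ← γ_pow_succ_apply] at hm
      rw [hm, length_pre]
  funext i
  have e : pre w _ = pre xγ _ := (key i).trans (pre_xγ i).symm
  have e' := List.map_inj_left.1 (FreeMonoid.ofList.injective e)
  exact e' i (List.mem_range.2 (lt_length_γ_pow_a i))

end MorphicWords

namespace MorphicWords

open FreeMonoid (of)

/-! Since `γ ∘ π = π ∘ σ` for the binary morphism σ : x ↦ xy, y ↦ xxy (`sturm`), `xγ` is the π-image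
of the fixed point s of σ. As `xγ` is a product of blocks ac and ab, φ acts on it only through φ(ac)
and φ(ab), which gives the inclusion ⊇. Conversely, if φ fixes `xγ`, the position of the letter a
forces φ(ac) = π(u) and φ(ab) = π(v) (`exists_pairWord_of_subst_prefix`), so x ↦ u, y ↦ v fixes s.
Such a binary morphism is a power of σ (`exists_iterate_sturm`), by descent on |uv|: when |uv| ≥ 5,
neither u nor v ends in x, as xxyxxy is not a factor of s; hence both desubstitute through σ.
Shorter pairs are checked by computation. -/

/-- The morphism from binary words sending `false` to `u` and `true` to `v`. -/
def subst {α : Type*} (u v : List α) (w : List Bool) : List α :=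
  w.flatMap fun b => if b then v else u

section subst

variable {α : Type*} (u v : List α)

@[simp] theorem subst_nil : subst u v [] = [] := rfl

@[simp] theorem subst_false (w : List Bool) : subst u v (false :: w) = u ++ subst u v w := rfl

@[simp] theorem subst_true (w : List Bool) : subst u v (true :: w) = v ++ subst u v w := rfl

theorem subst_append (w z : List Bool) : subst u v (w ++ z) = subst u v w ++ subst u v z :=
  List.flatMap_append

theorem subst_subst (s t w : List Bool) :
    subst u v (subst s t w) = subst (subst u v s) (subst u v t) w := by
  induction w with
  | nil => rfl
  | cons b w ih => cases b <;> simp [subst_append, ih]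

theorem map_subst {β : Type*} (f : FreeMonoid α →* FreeMonoid β) (w : List Bool) :
    f (FreeMonoid.ofList (subst u v w)) = FreeMonoid.ofList
      (subst (f (FreeMonoid.ofList u)).toList (f (FreeMonoid.ofList v)).toList w) := by
  induction w with
  | nil => exact map_one f
  | cons b w ih => cases b <;> simp [FreeMonoid.ofList_append, ih]

end subst

/-! ### The binary substitution and its factors -/

/-- The binary morphism `x ↦ xy, y ↦ xxy`, with `false` for `x` and `true` for `y`. -/
def sturm (w : List Bool) : List Bool := subst [false, true] [false, false, true] w

@[simp] theorem sturm_nil : sturm [] = [] := rfl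

@[simp] theorem sturm_false (w : List Bool) :
    sturm (false :: w) = false :: true :: sturm w := rfl

@[simp] theorem sturm_true (w : List Bool) :
    sturm (true :: w) = false :: false :: true :: sturm w := rfl

theorem sturm_append (w z : List Bool) : sturm (w ++ z) = sturm w ++ sturm z :=
  subst_append ..

theorem sturm_subst (u v w : List Bool) :
    sturm (subst u v w) = subst (sturm u) (sturm v) w :=
  subst_subst ..

theorem length_sturm (w : List Bool) : 2 * w.length ≤ (sturm w).length := by
  induction w with
  | nil => simp
  | cons b w ih => cases b <;> simp <;> omega

/-- The blocks xy and xxy form a prefix code. -/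
theorem prefix_of_sturm_prefix {w z : List Bool} (h : sturm w <+: sturm z) : w <+: z := by
  induction w generalizing z with
  | nil => simp
  | cons b w ih =>
    rcases z with _ | ⟨c, z⟩
    · cases b <;> simp at h
    · cases b <;> cases c <;> simp at h ⊢
      · exact ih h
      · exact ih h

theorem not_true_true_infix_sturm (w : List Bool) : ¬ [true, true] <:+: sturm w := by
  have h0 (w : List Bool) : ¬ [true] <+: sturm w := by
    rcases w with _ | ⟨_ | _, w⟩ <;> simp
  induction w with
  | nil => simp
  | cons b w ih =>
    cases b <;> simp only [sturm_false, sturm_true, List.infix_cons_iff, List.cons_prefix_cons] <;>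
      simp [ih, h0]

/-- Each block starts with x and ends with its only y, so xx occurs only at the start of the block
of y. -/
theorem true_true_infix_of_sturm {w : List Bool}
    (h : [false, false, true, false, false, true] <:+: sturm w) : [true, true] <:+: w := by
  have h0 (w : List Bool) (h : [false, false, true] <+: sturm w) : [true] <+: w := by
    rcases w with _ | ⟨_ | _, w⟩ <;> simp_all
  induction w with
  | nil => simp at h
  | cons b w ih =>
    cases b <;>
      simp only [sturm_false, sturm_true, List.infix_cons_iff, List.cons_prefix_cons] at h ⊢
    · simp at h
      exact Or.inr (ih h)
    · simp at h
      rcases h with h | h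
      · exact Or.inl ⟨trivial, h0 w h⟩
      · exact Or.inr (ih h)

/-! ### The binary fixed point and its prefixes -/

/-- The iterates of `sturm` on the word `x`. -/
def sturmWord (n : ℕ) : List Bool := sturm^[n] [false]

theorem sturmWord_succ (n : ℕ) : sturmWord (n + 1) = sturm (sturmWord n) :=
  Function.iterate_succ_apply' ..

theorem sturmWord_prefix_succ (n : ℕ) : sturmWord n <+: sturmWord (n + 1) := by
  induction n with
  | zero => exact ⟨[true], rfl⟩
  | succ n ih =>
    obtain ⟨t, ht⟩ := ih
    exact ⟨sturm t, by rw [sturmWord_succ, sturmWord_succ, ← sturm_append, ht]⟩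

theorem sturmWord_prefix {m n : ℕ} (h : m ≤ n) : sturmWord m <+: sturmWord n := by
  induction n, h using Nat.le_induction with
  | base => exact List.prefix_rfl
  | succ n _ ih => exact ih.trans (sturmWord_prefix_succ n)

theorem lt_length_sturmWord (n : ℕ) : n < (sturmWord n).length := by
  induction n with
  | zero => exact Nat.zero_lt_one
  | succ n ih =>
    rw [sturmWord_succ]
    have := length_sturm (sturmWord n)
    omega

theorem not_infix_sturmWord (n : ℕ) :
    ¬ [false, false, true, false, false, true] <:+: sturmWord n := by
  rcases n with _ | _ | n
  · decide
  · decide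
  · rw [sturmWord_succ, sturmWord_succ]
    exact fun h => not_true_true_infix_sturm _ (true_true_infix_of_sturm h)

/-- `IsPre u` says that `u` is a prefix of the fixed point of `sturm`. -/
def IsPre (u : List Bool) : Prop := ∃ n, u <+: sturmWord n

theorem IsPre.of_prefix {u v : List Bool} (h : IsPre v) (huv : u <+: v) : IsPre u :=
  h.imp fun _ hn => huv.trans hn

theorem IsPre.prefix_sturmWord {u : List Bool} (h : IsPre u) {n : ℕ}
    (hn : u.length ≤ (sturmWord n).length) : u <+: sturmWord n := by
  obtain ⟨m, hm⟩ := h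
  rcases le_total m n with hmn | hmn
  · exact hm.trans (sturmWord_prefix hmn)
  · exact List.prefix_of_prefix_length_le hm (sturmWord_prefix hmn) hn

theorem IsPre.prefix_of_length_le {u v : List Bool} (hu : IsPre u) (hv : IsPre v)
    (h : u.length ≤ v.length) : u <+: v := by
  obtain ⟨n, hn⟩ := hv
  exact List.prefix_of_prefix_length_le (hu.prefix_sturmWord (h.trans hn.length_le)) hn h

theorem IsPre.of_sturm {u : List Bool} (h : IsPre (sturm u)) : IsPre u := by
  obtain ⟨n, hn⟩ := h
  refine ⟨n, prefix_of_sturm_prefix ?_⟩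
  rw [← sturmWord_succ]
  exact hn.trans (sturmWord_prefix_succ n)

/-! ### Desubstitution and the binary stabilizer -/

/-- Cutting strictly inside a block leaves x as the last letter on the left, so any other cut falls
between blocks. -/
theorem exists_sturm_of_append {u r w : List Bool} (h : u ++ r = sturm w)
    (hu : ∀ t, u ≠ t ++ [false]) : ∃ u' r', u = sturm u' ∧ r = sturm r' := by
  induction w generalizing u with
  | nil =>
    obtain ⟨rfl, rfl⟩ := List.append_eq_nil_iff.1 h
    exact ⟨[], [], rfl, rfl⟩
  | cons b w ih =>
    have hu' (s : List Bool) (v : List Bool) (hs : u = s ++ v) : ∀ t, v ≠ t ++ [false] := by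
      rintro t rfl
      exact hu (s ++ t) (by rw [hs, List.append_assoc])
    rcases u with _ | ⟨x, u⟩
    · exact ⟨[], _, rfl, h⟩
    rcases u with _ | ⟨y, u⟩
    · exfalso
      cases b <;> simp at h <;> exact hu [] (by simp [h.1])
    cases b
    · simp at h
      obtain ⟨rfl, rfl, h⟩ := h
      obtain ⟨u', r', rfl, rfl⟩ := ih h (hu' [false, true] u rfl)
      exact ⟨false :: u', r', rfl, rfl⟩
    · simp at h
      obtain ⟨rfl, rfl, h⟩ := h
      rcases u with _ | ⟨z, u⟩
      · exact absurd rfl (hu [false])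
      · simp at h
        obtain ⟨rfl, h⟩ := h
        obtain ⟨u', r', rfl, rfl⟩ := ih h (hu' [false, false, true] u rfl)
        exact ⟨true :: u', r', rfl, rfl⟩

theorem subst_eq_of_length_lt {u v : List Bool} (h : IsPre (subst u v (sturmWord 4)))
    (hne : u ++ v ≠ []) (hlt : (u ++ v).length < 5) : u = [false] ∧ v = [true] := by
  have hpre : u ++ v <+: sturmWord 2 := by
    refine IsPre.prefix_sturmWord (h.of_prefix ⟨subst u v ((sturmWord 4).drop 2), ?_⟩) hlt.le
    rw [show sturmWord 4 = false :: true :: (sturmWord 4).drop 2 by decide]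
    simp
  have hlen : (subst u v (sturmWord 4)).length ≤ (sturmWord 6).length := by
    have e : (subst u v (sturmWord 4)).length = 17 * u.length + 12 * v.length := by
      simp only [show sturmWord 4 = [false, true, false, false, true, false, true, false, true,
        false, false, true, false, true, false, false, true, false, true, false, false, true,
        false, true, false, true, false, false, true] by decide, subst_false, subst_true,
        subst_nil, List.length_append, List.length_nil]
      ring
    have : (sturmWord 6).length = 169 := by decide +kernel
    simp at hlt
    omega
  have hfin := h.prefix_sturmWord hlen
  -- Here i is |uv| and j is |u|: since uv is a prefix of xyxxy, these two lengths determine u and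
  -- v.
  have key : ∀ i j : Fin 5,
      (subst (((sturmWord 2).take i.1).take j.1) (((sturmWord 2).take i.1).drop j.1)
        (sturmWord 4)).isPrefixOf (sturmWord 6) = true → i.1 ≠ 0 → i.1 = 2 ∧ j.1 = 1 := by
    decide +kernel
  have e1 : u ++ v = (sturmWord 2).take (u ++ v).length := List.prefix_iff_eq_take.1 hpre
  have e2 : u = ((sturmWord 2).take (u ++ v).length).take u.length := by
    rw [← e1, List.take_left]
  have e3 : v = ((sturmWord 2).take (u ++ v).length).drop u.length := by
    rw [← e1, List.drop_left]
  obtain ⟨k1, k2⟩ := key ⟨(u ++ v).length, hlt⟩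
    ⟨u.length, lt_of_le_of_lt (by simp) hlt⟩
    (by rw [← e2, ← e3]; exact List.isPrefixOf_iff_prefix.2 hfin) (by simpa using hne)
  simp only at k1 k2
  rw [k1, k2] at e2 e3
  exact ⟨e2, e3⟩

/-- The binary morphisms fixing the fixed point of `sturm` are the powers of `sturm`. -/
theorem exists_iterate_sturm {u v : List Bool} (h : ∀ n, IsPre (subst u v (sturmWord n)))
    (hne : u ++ v ≠ []) : ∃ k, u = sturm^[k] [false] ∧ v = sturm^[k] [true] := by
  induction hl : (u ++ v).length using Nat.strong_induction_on generalizing u v with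
  | _ l ih =>
  rcases lt_or_ge (u ++ v).length 5 with hlt | hge
  · exact ⟨0, subst_eq_of_length_lt (h 4) hne hlt⟩
  -- The third iterate xyxxyxyxyxxy contains both x·xy and y·xy, so u and v each occur followed by
  -- uv.
  have h3 : IsPre (u ++ v ++ (u ++ u ++ v ++ (u ++ v ++ u ++ v ++ u ++ u ++ v))) := by
    have := h 3
    rw [show sturmWord 3 = [false, true, false, false, true, false, true, false, true,
        false, false, true] by decide] at this
    simpa using this
  have hstart : [false, true, false, false, true] <+: u ++ v :=
    IsPre.prefix_of_length_le ⟨2, List.prefix_rfl⟩ (h3.of_prefix (List.prefix_append _ _)) hge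
  -- An x just before uv, which starts with xyxxy, would create the forbidden factor xxyxxy.
  have hinf (t s r : List Bool) : ¬ IsPre (s ++ (t ++ [false] ++ (u ++ v)) ++ r) := by
    rintro ⟨n, hn⟩
    obtain ⟨q, hq⟩ := hstart
    refine not_infix_sturmWord n (List.IsInfix.trans ?_ hn.isInfix)
    exact ⟨s ++ t, q ++ r, by rw [← hq]; simp⟩
  have hu (t : List Bool) : u ≠ t ++ [false] := by
    intro e
    refine hinf t (u ++ v) (u ++ v ++ u ++ v ++ u ++ u ++ v) ?_
    rw [← e]
    simpa using h3
  have hv (t : List Bool) : v ≠ t ++ [false] := by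
    intro e
    refine hinf t (u ++ v ++ u ++ u) (u ++ v ++ u ++ u ++ v) ?_
    rw [← e]
    simpa using h3
  obtain ⟨n, hn⟩ := h3
  obtain ⟨r, hr⟩ := hn.trans (sturmWord_prefix_succ n)
  rw [sturmWord_succ, List.append_assoc, List.append_assoc] at hr
  obtain ⟨u', r', rfl, hr'⟩ := exists_sturm_of_append hr hu
  obtain ⟨v', -, rfl, -⟩ := exists_sturm_of_append hr' hv
  have hlen := length_sturm (u' ++ v')
  rw [sturm_append] at hlen
  -- The measure drops because `sturm` at least doubles lengths.
  obtain ⟨k, rfl, rfl⟩ := ih (u' ++ v').length (by omega)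
    (fun n => IsPre.of_sturm (by rw [sturm_subst]; exact h n))
    (by rintro e; rw [e] at hlen; rw [← sturm_append, e] at hge; simp at hge) rfl
  exact ⟨k + 1, (Function.iterate_succ_apply' ..).symm, (Function.iterate_succ_apply' ..).symm⟩

/-! ### Transfer between the binary and ternary words -/

/-- The morphism `π` on binary words: `false ↦ ac`, `true ↦ ab`. -/
def pairWord (w : List Bool) : List ABC := subst [ABC.a, ABC.c] [ABC.a, ABC.b] w

@[simp] theorem pairWord_nil : pairWord [] = [] := rfl

@[simp] theorem pairWord_false (w : List Bool) :
    pairWord (false :: w) = ABC.a :: ABC.c :: pairWord w := rfl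

@[simp] theorem pairWord_true (w : List Bool) :
    pairWord (true :: w) = ABC.a :: ABC.b :: pairWord w := rfl

theorem length_pairWord (w : List Bool) : (pairWord w).length = 2 * w.length := by
  induction w with
  | nil => rfl
  | cons b w ih => cases b <;> simp [ih] <;> omega

theorem prefix_of_pairWord_prefix {w z : List Bool} (h : pairWord w <+: pairWord z) :
    w <+: z := by
  induction w generalizing z with
  | nil => simp
  | cons b w ih =>
    rcases z with _ | ⟨c, z⟩
    · cases b <;> simp at h
    · cases b <;> cases c <;> simp at h ⊢
      · exact ih h
      · exact ih h

/-- The letter a occurs only at the start of a two-letter block, so a cut just before an a respects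
the coding. -/
theorem exists_pairWord_of_append {u r : List ABC} {w : List Bool}
    (h : u ++ ABC.a :: r = pairWord w) :
    ∃ u' r', u = pairWord u' ∧ ABC.a :: r = pairWord r' := by
  induction w generalizing u with
  | nil => simp at h
  | cons b w ih =>
    rcases u with _ | ⟨x, _ | ⟨y, u⟩⟩
    · exact ⟨[], _, rfl, h⟩
    · cases b <;> simp at h
    · cases b <;> simp at h <;> obtain ⟨rfl, rfl, h⟩ := h <;>
        obtain ⟨u', r', rfl, hr⟩ := ih h
      · exact ⟨false :: u', r', rfl, hr⟩
      · exact ⟨true :: u', r', rfl, hr⟩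

theorem exists_pairWord_of_pairWord_append {u z : List Bool} {r : List ABC}
    (h : pairWord u ++ r = pairWord z) : ∃ v, r = pairWord v := by
  obtain ⟨v, rfl⟩ := prefix_of_pairWord_prefix ⟨r, h⟩
  exact ⟨v, List.append_cancel_left (h.trans (subst_append ..))⟩

theorem map_pairWord (φ : Monoid.End (FreeMonoid ABC)) (w : List Bool) :
    φ (FreeMonoid.ofList (pairWord w)) = FreeMonoid.ofList
      (subst (φ (of ABC.a * of ABC.c)).toList (φ (of ABC.a * of ABC.b)).toList w) :=
  map_subst _ _ φ w

theorem γ_pairWord (w : List Bool) :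
    γ (FreeMonoid.ofList (pairWord w)) = FreeMonoid.ofList (pairWord (sturm w)) := by
  rw [map_pairWord, pairWord, sturm, subst_subst]
  rfl

theorem γ_pow_pairWord (k : ℕ) (w : List Bool) :
    (γ ^ k) (FreeMonoid.ofList (pairWord w)) =
      FreeMonoid.ofList (pairWord (sturm^[k] w)) := by
  induction k with
  | zero => rfl
  | succ k ih => rw [γ_pow_succ_apply, ih, γ_pairWord, Function.iterate_succ_apply']

theorem pre_xγ_eq_pairWord (n : ℕ) :
    pre xγ (2 * (sturmWord n).length) = FreeMonoid.ofList (pairWord (sturmWord n)) := by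
  -- This is γⁿ(ac)·γⁿ(a) = γⁿ⁺¹(a), as γ(a) = aca.
  have h : FreeMonoid.ofList (pairWord (sturmWord n)) * (γ ^ n) (of ABC.a) =
      pre xγ ((γ ^ (n + 1)) (of ABC.a)).length := by
    rw [pre_xγ, sturmWord, ← γ_pow_pairWord, ← map_mul, pow_succ]
    rfl
  rw [eq_pre_of_mul h, ← length_pairWord]
  rfl

theorem exists_pre_mul (n : ℕ) :
    ∃ t, FreeMonoid.ofList (pairWord (sturmWord n)) = pre xγ n * t := by
  rw [← pre_xγ_eq_pairWord]
  have := lt_length_sturmWord n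
  obtain ⟨k, hk⟩ := Nat.exists_eq_add_of_le (show n ≤ 2 * (sturmWord n).length by omega)
  rw [hk]
  exact pre_add xγ n k

theorem exists_pairWord_of_subst_prefix {A B : List ABC}
    (h : ∃ m, subst A B (sturmWord 3) <+: pairWord (sturmWord m)) :
    ∃ u v, A = pairWord u ∧ B = pairWord v := by
  obtain ⟨m, r, hr⟩ := h
  rw [show sturmWord 3 = [false, true, false, false, true, false, true, false, true,
        false, false, true] by decide] at hr
  obtain ⟨w, hw⟩ : ∃ w, sturmWord m = false :: w := by
    obtain ⟨t, ht⟩ := sturmWord_prefix (Nat.zero_le m)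
    exact ⟨t, ht.symm⟩
  rcases A with _ | ⟨x, A⟩
  · refine ⟨[], ?_⟩
    rcases B with _ | ⟨x, B⟩
    · exact ⟨[], rfl, rfl⟩
    · obtain rfl : x = ABC.a := by rw [hw] at hr; simp at hr; exact hr.1
      obtain ⟨v, -, hv, -⟩ := exists_pairWord_of_append (u := ABC.a :: B)
        (r := B ++ (ABC.a :: B ++ (ABC.a :: B ++ (ABC.a :: B ++ r)))) (w := sturmWord m)
        (by rw [← hr]; simp)
      exact ⟨v, rfl, hv⟩
  · obtain rfl : x = ABC.a := by rw [hw] at hr; simp at hr; exact hr.1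
    -- The image begins ABAA: cutting before the second A decodes AB, then cutting between the
    -- adjacent copies of A decodes A, and cancellation decodes B.
    obtain ⟨z, w1, hz, h1⟩ := exists_pairWord_of_append (u := ABC.a :: A ++ B)
        (r := A ++ (ABC.a :: A ++ (B ++ (ABC.a :: A ++ (B ++ (ABC.a :: A ++ (B ++
          (ABC.a :: A ++ (ABC.a :: A ++ (B ++ r))))))))))
        (w := sturmWord m) (by rw [← hr]; simp)
    obtain ⟨u, -, hu, -⟩ := exists_pairWord_of_append (u := ABC.a :: A)
        (r := A ++ (B ++ (ABC.a :: A ++ (B ++ (ABC.a :: A ++ (B ++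
          (ABC.a :: A ++ (ABC.a :: A ++ (B ++ r))))))))) (w := w1) (by rw [← h1]; simp)
    rw [hu] at hz ⊢
    exact ⟨u, (exists_pairWord_of_pairWord_append hz).imp fun v hv => ⟨rfl, hv⟩⟩

theorem mem_stabilizer_xγ_iff (φ : Monoid.End (FreeMonoid ABC)) :
    φ ∈ stabilizer xγ ↔ ∃ k : ℕ,
      φ (of ABC.a * of ABC.c) = (γ ^ k) (of ABC.a * of ABC.c) ∧
      φ (of ABC.a * of ABC.b) = (γ ^ k) (of ABC.a * of ABC.b) := by
  constructor
  · rintro ⟨h1, h2⟩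
    have hpre (n : ℕ) : ∃ m, subst (φ (of ABC.a * of ABC.c)).toList
        (φ (of ABC.a * of ABC.b)).toList (sturmWord n) <+: pairWord (sturmWord m) := by
      obtain ⟨m, hm⟩ := h1 (2 * (sturmWord n).length)
      obtain ⟨t, ht⟩ := exists_pre_mul m
      rw [pre_xγ_eq_pairWord, map_pairWord] at hm
      rw [← hm] at ht
      exact ⟨m, t.toList, (congrArg FreeMonoid.toList ht).symm⟩
    obtain ⟨u, v, hu, hv⟩ := exists_pairWord_of_subst_prefix (hpre 3)
    have hne : u ++ v ≠ [] := by
      intro e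
      obtain ⟨rfl, rfl⟩ := List.append_eq_nil_iff.1 e
      -- Unboundedness of the partial products excludes a φ that erases both ac and ab.
      obtain ⟨n, hn⟩ := h2 1
      obtain ⟨t, ht⟩ := exists_pre_mul n
      have h0 : φ (FreeMonoid.ofList (pairWord (sturmWord n))) = 1 := by
        rw [map_pairWord, hu, hv]
        exact congrArg FreeMonoid.ofList (List.flatMap_eq_nil_iff.2 fun b _ => by simp)
      rw [ht, map_mul] at h0
      have hl := congrArg FreeMonoid.length h0
      rw [FreeMonoid.length_mul, FreeMonoid.length_one] at hl
      omega
    obtain ⟨k, rfl, rfl⟩ := exists_iterate_sturm (u := u) (v := v) (fun n => by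
      obtain ⟨m, hm⟩ := hpre n
      rw [hu, hv, pairWord, pairWord, ← subst_subst] at hm
      exact ⟨m, prefix_of_pairWord_prefix hm⟩) hne
    refine ⟨k, FreeMonoid.toList.injective ?_, FreeMonoid.toList.injective ?_⟩
    · exact hu.trans (congrArg FreeMonoid.toList (γ_pow_pairWord k [false])).symm
    · exact hv.trans (congrArg FreeMonoid.toList (γ_pow_pairWord k [true])).symm
  · rintro ⟨k, hc, hb⟩
    have key (n : ℕ) : φ (FreeMonoid.ofList (pairWord (sturmWord n))) =
        FreeMonoid.ofList (pairWord (sturmWord (k + n))) := by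
      rw [map_pairWord, hc, hb, ← map_pairWord, γ_pow_pairWord, sturmWord, sturmWord,
        Function.iterate_add_apply]
    refine ⟨fun n => ?_, fun m => ⟨2 * (sturmWord m).length, ?_⟩⟩
    · obtain ⟨t, ht⟩ := exists_pre_mul n
      have e := key n
      rw [ht, map_mul, ← pre_xγ_eq_pairWord] at e
      exact ⟨_, eq_pre_of_mul e⟩
    · rw [pre_xγ_eq_pairWord, key, ← pre_xγ_eq_pairWord, length_pre]
      have := lt_length_sturmWord (k + m)
      omega

theorem comp_π_eq_iff (φ ψ : Monoid.End (FreeMonoid ABC)) :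
    ⇑φ ∘ ⇑π = ⇑ψ ∘ ⇑π ↔ φ (of ABC.a * of ABC.c) = ψ (of ABC.a * of ABC.c) ∧
      φ (of ABC.a * of ABC.b) = ψ (of ABC.a * of ABC.b) := by
  constructor
  · exact fun h => ⟨congrFun h (of XY.x), congrFun h (of XY.y)⟩
  · rintro ⟨hc, hb⟩
    have : (MonoidHom.comp φ π : FreeMonoid XY →* FreeMonoid ABC) = MonoidHom.comp ψ π := by
      refine FreeMonoid.hom_eq fun l => ?_
      cases l
      · exact hc
      · exact hb
    exact congrArg DFunLike.coe this

end MorphicWords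

open MorphicWords in
theorem mainTheorem2 :
    ((stabilizer xγ : Set (Monoid.End (FreeMonoid ABC))) =
      {φ : Monoid.End (FreeMonoid ABC) | ∃ k : ℕ,
        ⇑φ ∘ ⇑π = ⇑(γ ^ k) ∘ ⇑π}) ∧
    (∀ φ : Monoid.End (FreeMonoid ABC),
      φ ∈ stabilizer xγ ↔ ∃ k : ℕ,
        φ (FreeMonoid.of ABC.a * FreeMonoid.of ABC.c) =
          (γ ^ k) (FreeMonoid.of ABC.a * FreeMonoid.of ABC.c) ∧
        φ (FreeMonoid.of ABC.a * FreeMonoid.of ABC.b) =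
          (γ ^ k) (FreeMonoid.of ABC.a * FreeMonoid.of ABC.b)) := by
  refine ⟨Set.ext fun φ => ?_, mem_stabilizer_xγ_iff⟩
  simp only [Set.mem_ofPred_eq, comp_π_eq_iff]
  exact mem_stabilizer_xγ_iff φ
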